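/- All graphs are finite and loopless and may have multiple edges. A signed graph $(G,\sigma)$ is a graph $G$ with a signature $\sigma:E(G)\to\{+1,-1\}$. Regard each edge $e=uv$ as two half edges $h_e^u$ (at $u$) and $h_e^v$ (at $v$). An orientation of $(G,\sigma)$ is a map $\tau$ from the half edges to $\{+1,-1\}$ with $\tau(h_e^u)\,\tau(h_e^v)=-\sigma(e)$ for every edge $e=uv$. For a positive integer $k$, a nowhere-zero $k$-flow ($k$-NZF) of $(G,\sigma)$ is a pair $(\tau,f)$, where $\tau$ is an orientation of $(G,\sigma)$ and $f:E(G)\to\mathbb Z$ satisfies $0<|f(e)|<k$ for every edge $e$ and $\sum_{e\ni v}\tau(h_e^v)f(e)=0$ for every vertex $v$. The signed graph $(G,\sigma)$ is flow-admissible if it admits a $k$-NZF for some integer $k$. A nowhere-zero flow of an unsigned graph $G$ is one of $G$ with all edges positive. A graph is cubic if every vertex has degree $3$, and $3$-edge-colorable if its edges can be colored with three colors so that distinct edges with a common end have distinct colors. Theorem 3.3. For each positive integer $k$ the following are equivalent: (1) every flow-admissible signed graph whose underlying graph admits a nowhere-zero $4$-flow admits a $k$-NZF; (2) every flow-admissible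 signed graph whose underlying graph is cubic and $3$-edge-colorable admits a $k$-NZF. -/

import Mathlib

universe u

open scoped Graph

namespace SignedFlow

/- A multigraph is Mathlib's `Graph α β`, with vertex set `V(G)` and edge set `E(G)`.  A signed graph
is a pair `(G, σ)` with `σ : β → ℤˣ`; only the values of `σ` on `E(G)` ever matter. -/

variable {α β : Type*}

/-- `G` has finitely many vertices, finitely many edges, and no loops. -/
structure IsFiniteLoopless (G : Graph α β) : Prop where
  finite_vertexSet : V(G).Finite
  finite_edgeSet : E(G).Finite
  loopless : G.Loopless

/-- `τ` is an orientation of the signed graph `(G, σ)`. For an edge `e` incident with `v`, the sign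
`τ e v` is the value at the half edge of `e` at `v`: it is `1` if that half edge is directed away
from `v`, and `-1` if it is directed toward `v`. Values at other pairs are irrelevant. -/
def IsOrientation (G : Graph α β) (σ : β → ℤˣ) (τ : β → α → ℤˣ) : Prop :=
  ∀ ⦃e : β⦄ ⦃u v : α⦄, G.IsLink e u v → τ e u * τ e v = -σ e

/-- The boundary of `f` at `v`: the signed sum of `f` over the half edges at `v`. (In a loopless
graph there is one half edge at `v` for each edge incident with `v`.) -/
noncomputable def boundary (G : Graph α β) (τ : β → α → ℤˣ) (f : β → ℤ) (v : α) : ℤ :=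
  ∑ᶠ e ∈ G.incidenceSet v, (τ e v : ℤ) * f e

/-- `(τ, f)` is a `k`-flow of the signed graph `(G, σ)`. -/
structure IsFlow (G : Graph α β) (σ : β → ℤˣ) (k : ℕ) (τ : β → α → ℤˣ) (f : β → ℤ) : Prop where
  isOrientation : IsOrientation G σ τ
  boundary_eq_zero : ∀ v ∈ V(G), boundary G τ f v = 0
  abs_lt : ∀ e ∈ E(G), |f e| < k

/-- `(τ, f)` is a nowhere-zero `k`-flow of the signed graph `(G, σ)`. -/
structure IsNowhereZeroFlow (G : Graph α β) (σ : β → ℤˣ) (k : ℕ) (τ : β → α → ℤˣ) (f : β → ℤ) :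
    Prop extends IsFlow G σ k τ f where
  ne_zero : ∀ e ∈ E(G), f e ≠ 0

/-- The signed graph `(G, σ)` admits a nowhere-zero `k`-flow. -/
def AdmitsNZF (G : Graph α β) (σ : β → ℤˣ) (k : ℕ) : Prop :=
  ∃ (τ : β → α → ℤˣ) (f : β → ℤ), IsNowhereZeroFlow G σ k τ f

/-- The signed graph `(G, σ)` is flow-admissible: it admits a nowhere-zero `k`-flow for some `k`. -/
def FlowAdmissible (G : Graph α β) (σ : β → ℤˣ) : Prop :=
  ∃ k : ℕ, AdmitsNZF G σ k

/-- The ordinary graph `G`, regarded as an all-positive signed graph, admits a nowhere-zero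
`4`-flow. -/
def IsFourNZFAdmissible (G : Graph α β) : Prop :=
  AdmitsNZF G (fun _ => 1) 4

/-- Every vertex of the (loopless) graph `G` has degree `3`. -/
def IsCubic (G : Graph α β) : Prop :=
  ∀ v ∈ V(G), (G.incidenceSet v).ncard = 3

/-- `G` has a proper edge colouring with `3` colours: distinct edges with a common end get distinct
colours. -/
def IsThreeEdgeColorable (G : Graph α β) : Prop :=
  ∃ c : β → Fin 3, ∀ v ∈ V(G), Set.InjOn c (G.incidenceSet v)

end SignedFlow

namespace SignedFlow

/-! ### Two fixed-point-free involutions -/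

/-! (2) follows from (1) because a 3-edge-coloured cubic graph has a nowhere-zero 4-flow: the union
of two colour classes has an Eulerian orientation, and two such unions combine as `y₁ + 2 * y₂`.

For the converse, a 4-flow yields a nowhere-zero Klein four-group flow `c` (`exists_klein_flow`). At
each vertex the half edges are put in a cyclic order along which the partial sums of `c`, from a
suitable start, never vanish (`exists_list_avoidsZero`). Replacing each vertex by a circuit in this
order gives a cubic graph, 3-edge-coloured by `c` and the partial sums. With positive circuit edges,
an integer flow extends over each circuit because its boundary vanishes, and a large constant
circulation makes the new values nonzero. Conversely, contracting the circuits turns a `k`-NZF of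
the expansion into one of the original graph. -/

theorem exists_sign_of_involutive {Q : Type*} (a : Q → Q) (ha : Function.Involutive a)
    (ha' : ∀ x, a x ≠ x) : ∃ χ : Q → ℤˣ, ∀ x, χ (a x) = -χ x := by
  classical
  let _ : LinearOrder Q := linearOrderOfSTO WellOrderingRel
  refine ⟨fun x => if x < a x then 1 else -1, fun x => ?_⟩
  have h := ha x
  rcases lt_or_gt_of_ne (ha' x) with hlt | hlt
  · simp [h, hlt, hlt.not_gt]
  · simp [h, hlt, hlt.not_gt]

/-- Two fixed-point-free involutions have a common `2`-colouring: a union of two perfect matchings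
is bipartite. -/
theorem exists_sign_of_involutive_of_involutive {X : Type*} (a b : X → X)
    (ha : Function.Involutive a) (hb : Function.Involutive b)
    (ha' : ∀ x, a x ≠ x) (hb' : ∀ x, b x ≠ x) :
    ∃ χ : X → ℤˣ, (∀ x, χ (a x) = -χ x) ∧ ∀ x, χ (b x) = -χ x := by
  set A : Equiv.Perm X := ha.toPerm a with hA
  set B : Equiv.Perm X := hb.toPerm b with hB
  have hAx : ∀ x, A x = a x := fun _ => rfl
  have hBx : ∀ x, B x = b x := fun _ => rfl
  have hAA : A * A = 1 := by ext x; exact ha x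
  have hBB : B * B = 1 := by ext x; exact hb x
  have hAi : A⁻¹ = A := inv_eq_of_mul_eq_one_left hAA
  have hBi : B⁻¹ = B := inv_eq_of_mul_eq_one_left hBB
  have hconj : ∀ n : ℤ, A * (A * B) ^ n = (A * B) ^ (-n) * A := by
    intro n
    have h1 : A * (A * B) * A⁻¹ = (A * B)⁻¹ := by
      rw [mul_inv_rev, hAi, hBi, ← mul_assoc, hAA, one_mul]
    have h2 : A * (A * B) ^ n * A⁻¹ = (A * B) ^ (-n) := by
      rw [← conj_zpow, h1, inv_zpow, zpow_neg]
    rw [← h2, inv_mul_cancel_right]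
  have hconj' : ∀ (n : ℤ) x, a (((A * B) ^ n) x) = ((A * B) ^ (-n)) (a x) := fun n x =>
    congrArg (fun p : Equiv.Perm X => p x) (hconj n)
  let r : Setoid X := Equiv.Perm.SameCycle.setoid (A * B)
  have hr : ∀ x y, r x y ↔ ∃ n : ℤ, ((A * B) ^ n) x = y := fun _ _ => Iff.rfl
  have hcompat : ∀ x y, r x y → r (a x) (a y) := by
    rintro x y ⟨n, rfl⟩
    exact ⟨-n, (hconj' n x).symm⟩
  -- `a` inverts `A * B`, so `a x = (A * B) ^ n x` would make the half-way point `(A * B) ^ m x`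
  -- fixed by `a` if `n = 2 * m`, and by `b` if `n = 2 * m + 1`. Hence `a` acts freely on the
  -- cycles, and a sign on cycles suffices, since `b x` lies in the cycle of `a x`.
  have hnot : ∀ x, ¬ r (a x) x := by
    intro x h
    obtain ⟨n, hn⟩ := r.symm h
    obtain ⟨m, rfl | rfl⟩ := Int.even_or_odd' n
    · apply ha' (((A * B) ^ m) x)
      rw [hconj', ← hn, ← Equiv.Perm.mul_apply, ← zpow_add]
      congr 2; ring
    · apply hb' (((A * B) ^ m) x)
      apply ha.injective
      rw [hconj', ← hn, ← Equiv.Perm.mul_apply, ← zpow_add]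
      have : -m + (2 * m + 1) = 1 + m := by ring
      rw [this, zpow_add, zpow_one]
      rfl
  let a' : Quotient r → Quotient r := Quotient.map a hcompat
  obtain ⟨χ, hχ⟩ := exists_sign_of_involutive a'
    (fun q => Quotient.inductionOn q fun x => congrArg (Quotient.mk r) (ha x))
    (fun q => Quotient.inductionOn q fun x h => hnot x (Quotient.exact h))
  refine ⟨fun x => χ (Quotient.mk r x), fun x => hχ (Quotient.mk r x), fun x => ?_⟩
  have hx : Quotient.mk r (b x) = a' (Quotient.mk r x) := by
    refine Quotient.sound (r.symm ⟨-1, ?_⟩)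
    rw [← hconj' 1, zpow_one]
    exact ha (b x)
  simp only [hx, hχ]

theorem exists_involutive_of_even_ncard {ι : Type*} {S : Set ι} (hS : S.Finite)
    (he : Even S.ncard) :
    ∃ b : S → S, Function.Involutive b ∧ ∀ i, b i ≠ i := by
  obtain ⟨n, hn⟩ := he
  have := hS.fintype
  have hcard : Fintype.card S = Fintype.card (Fin n × Bool) := by
    rw [Fintype.card_eq_nat_card, Nat.card_coe_set_eq, hn]
    simp [mul_two]
  let e := Fintype.equivOfCardEq hcard
  refine ⟨fun i => e.symm ((e i).1, !(e i).2), fun i => by simp, fun i h => ?_⟩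
  have := congrArg (fun j => (e j).2) h
  simp at this

/-! ### Cyclic orders with prescribed increments -/

section Cyclic

variable {ι M : Type*} [AddCommGroup M]

/-- All partial sums of `c` along the list, started at `s`, are nonzero. -/
def AvoidsZero (c : ι → M) : M → List ι → Prop
  | s, [] => s ≠ 0
  | s, i :: l => s ≠ 0 ∧ AvoidsZero c (s + c i) l

theorem AvoidsZero.append {c : ι → M} {l₁ l₂ : List ι} {s : M} (h₁ : AvoidsZero c s l₁)
    (h₂ : AvoidsZero c (s + (l₁.map c).sum) l₂) : AvoidsZero c s (l₁ ++ l₂) := by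
  induction l₁ generalizing s with
  | nil => simpa using h₂
  | cons i l ih =>
    refine ⟨h₁.1, ih h₁.2 ?_⟩
    simpa [add_assoc] using h₂

/-- A run of a single label of order dividing two visits only `s` and `s + γ`. -/
theorem AvoidsZero.of_forall_eq {c : ι → M} {γ : M} (hγ : γ + γ = 0) {l : List ι} {s : M}
    (hl : ∀ i ∈ l, c i = γ) (hs : s ≠ 0) (hs' : s + γ ≠ 0) : AvoidsZero c s l := by
  induction l generalizing s with
  | nil => exact hs
  | cons i l ih =>
    refine ⟨hs, ?_⟩
    rw [hl i (by simp)]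
    exact ih (fun j hj => hl j (by simp [hj])) hs' (by rwa [add_assoc, hγ, add_zero])

theorem AvoidsZero.add_sum_take_ne_zero {c : ι → M} {l : List ι} {s : M} (h : AvoidsZero c s l)
    (n : ℕ) : s + ((l.take n).map c).sum ≠ 0 := by
  induction l generalizing s n with
  | nil => simpa using (show s ≠ 0 from h)
  | cons i l ih =>
    cases n with
    | zero => simpa using h.1
    | succ n => simpa [add_assoc] using ih h.2 n

/-- The sum of `x` along the list up to and including `i`, started at `s`. -/
def listPotential [DecidableEq ι] (l : List ι) (x : ι → M) (s : M) (i : ι) : M :=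
  s + ((l.take (l.idxOf i + 1)).map x).sum

theorem listPotential_formPerm [DecidableEq ι] {l : List ι} (hl : l.Nodup) {x : ι → M}
    (hx : (l.map x).sum = 0) (s : M) {i : ι} (hi : i ∈ l) :
    listPotential l x s (l.formPerm i) = listPotential l x s i + x (l.formPerm i) := by
  obtain ⟨n, hn, rfl⟩ := List.mem_iff_getElem.1 hi
  have h0 : 0 < l.length := by omega
  rw [List.formPerm_apply_getElem l hl n hn]
  unfold listPotential
  rw [hl.idxOf_getElem, hl.idxOf_getElem]
  rcases Nat.lt_or_ge (n + 1) l.length with h | h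
  · simp only [Nat.mod_eq_of_lt h]
    rw [List.take_succ_eq_append_getElem h, List.map_append, List.sum_append, ← add_assoc]
    simp
  -- Wrapping from the last entry to the first is where the vanishing total is needed.
  · have hn' : n + 1 = l.length := by omega
    simp only [hn', Nat.mod_self, List.take_length, hx]
    rw [List.take_succ_eq_append_getElem h0]
    simp

/-- Group equal labels into runs. A run of `γ m` is safe when entered at a nonzero value other than
`γ m`. As the total is zero, the three label counts have the same parity. If all are odd, each run
moves the value and three consecutive runs work. If all are even, each run returns to its entry
value, which could not be safe for three labels, so one run is split into two odd pieces. -/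
theorem exists_list_avoidsZero [DecidableEq ι] (D : Finset ι) (c : ι → ZMod 2 × ZMod 2)
    (hc : ∀ i ∈ D, c i ≠ 0) (hsum : ∑ i ∈ D, c i = 0) :
    ∃ l : List ι, l.Nodup ∧ (∀ i, i ∈ l ↔ i ∈ D) ∧ ∃ s, AvoidsZero c s l := by
  let γ : Fin 3 → ZMod 2 × ZMod 2 := ![(1, 0), (0, 1), (1, 1)]
  have hγ : ∀ m, γ m + γ m = 0 := by decide
  let L : Fin 3 → List ι := fun m => (D.filter fun i => c i = γ m).toList
  have hL : ∀ m, ∀ i ∈ L m, c i = γ m := fun m i hi => by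
    simp only [L, Finset.mem_toList, Finset.mem_filter] at hi
    exact hi.2
  have hmem : ∀ m i, i ∈ L m ↔ i ∈ D ∧ c i = γ m := by simp [L]
  have hcov : ∀ z : ZMod 2 × ZMod 2, z ≠ 0 → z = γ 0 ∨ z = γ 1 ∨ z = γ 2 := by decide
  have hnd : (L 0 ++ L 2 ++ L 1).Nodup := by
    have hdis : ∀ m m', γ m ≠ γ m' → ∀ i ∈ L m, ∀ j ∈ L m', i ≠ j := by
      rintro m m' hne i hi j hj rfl
      exact hne ((hL m i hi).symm.trans (hL m' i hj))
    rw [List.nodup_append, List.nodup_append]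
    refine ⟨⟨Finset.nodup_toList _, Finset.nodup_toList _, hdis _ _ (by decide)⟩,
      Finset.nodup_toList _, fun i hi j hj => ?_⟩
    rcases List.mem_append.1 hi with hi | hi
    · exact hdis _ _ (by decide) i hi j hj
    · exact hdis _ _ (by decide) i hi j hj
  have hall : ∀ i, i ∈ L 0 ++ L 2 ++ L 1 ↔ i ∈ D := by
    intro i
    simp only [List.mem_append, hmem]
    constructor
    · rintro ((h | h) | h) <;> exact h.1
    · intro h
      rcases hcov _ (hc i h) with h' | h' | h' <;> simp [h, h']
  have hs : ∀ m (l : List ι), (∀ i ∈ l, c i = γ m) →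
      (l.map c).sum = 0 ∨ (l.map c).sum = γ m := by
    intro m l hl
    induction l with
    | nil => simp
    | cons i l ih =>
      rw [List.map_cons, List.sum_cons, hl i (by simp)]
      rcases ih (fun j hj => hl j (by simp [hj])) with h | h <;> simp [h, hγ]
  have htot : (((L 0).map c).sum + ((L 2).map c).sum) + ((L 1).map c).sum = 0 := by
    rw [← hsum, ← List.sum_append, ← List.map_append, ← List.sum_append, ← List.map_append]
    rw [← List.sum_toFinset c hnd]
    refine Finset.sum_congr ?_ fun _ _ => rfl
    ext i
    rw [List.mem_toFinset, hall]
  have key : (((L 0).map c).sum = 0 ∧ ((L 1).map c).sum = 0 ∧ ((L 2).map c).sum = 0) ∨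
      (((L 0).map c).sum = γ 0 ∧ ((L 1).map c).sum = γ 1 ∧ ((L 2).map c).sum = γ 2) := by
    rcases hs 0 _ (hL 0) with h0 | h0 <;> rcases hs 1 _ (hL 1) with h1 | h1 <;>
      rcases hs 2 _ (hL 2) with h2 | h2 <;> rw [h0, h1, h2] at htot ⊢ <;>
      first
      | exact Or.inl ⟨rfl, rfl, rfl⟩
      | exact Or.inr ⟨rfl, rfl, rfl⟩
      | exact absurd htot (by decide)
  rcases key with ⟨h0, h1, h2⟩ | ⟨h0, h1, h2⟩
  · rcases hL0 : L 0 with _ | ⟨i, t⟩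
    · rw [hL0] at hnd hall
      refine ⟨_, hnd, hall, γ 0, ?_⟩
      refine AvoidsZero.append (AvoidsZero.append (by decide : γ 0 ≠ 0) ?_) ?_
      · exact .of_forall_eq (hγ 2) (hL 2) (by simp; decide) (by simp; decide)
      · exact .of_forall_eq (hγ 1) (hL 1) (by simp [h2]; decide) (by simp [h2]; decide)
    -- The values entering the pieces `i`, `L 2`, `t`, `L 1` are `γ 2`, `γ 1`, `γ 1`, `γ 2`.
    · rw [hL0] at hnd hall h0
      have hi : c i = γ 0 := hL 0 i (by simp [hL0])
      have hperm : List.Perm (i :: t ++ L 2 ++ L 1) (i :: (L 2 ++ (t ++ L 1))) := by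
        rw [List.cons_append, List.cons_append]
        refine List.Perm.cons i ?_
        rw [← List.append_assoc]
        exact List.perm_append_comm.append_right _
      refine ⟨_, hperm.nodup hnd, fun j => by rw [← hperm.mem_iff, hall], γ 2, by decide, ?_⟩
      have ht : (t.map c).sum = γ 0 := by
        rw [List.map_cons, List.sum_cons, hi] at h0
        rw [← add_zero (List.sum _), ← hγ 0, add_comm, add_assoc, h0, add_zero]
      rw [hi]
      refine AvoidsZero.append ?_ (AvoidsZero.append ?_ ?_)
      · exact .of_forall_eq (hγ 2) (hL 2) (by decide) (by decide)
      · exact .of_forall_eq (hγ 0) (fun j hj => hL 0 j (by simp [hL0, hj]))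
          (by rw [h2]; decide) (by rw [h2]; decide)
      · exact .of_forall_eq (hγ 1) (hL 1) (by rw [h2, ht]; decide) (by rw [h2, ht]; decide)
  · refine ⟨_, hnd, hall, γ 2, ?_⟩
    refine AvoidsZero.append (AvoidsZero.append ?_ ?_) ?_
    · exact .of_forall_eq (hγ 0) (hL 0) (by decide) (by decide)
    · exact .of_forall_eq (hγ 2) (hL 2) (by rw [h0]; decide) (by rw [h0]; decide)
    · exact .of_forall_eq (hγ 1) (hL 1) (by rw [List.map_append, List.sum_append, h0, h2]; decide)
        (by rw [List.map_append, List.sum_append, h0, h2]; decide)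

/-- A finite set with nonzero labels in the Klein four-group that sum to zero has a cyclic order
whose gaps can be labelled by nonzero elements so that each label is the increment between the two
gaps around it. For integer labels that sum to zero such gap labels exist as well. -/
theorem exists_perm_potential (D : Finset ι) (c : ι → ZMod 2 × ZMod 2)
    (hc : ∀ i ∈ D, c i ≠ 0) (hsum : ∑ i ∈ D, c i = 0) :
    ∃ p : Equiv.Perm ι, (∀ i, p i ∈ D ↔ i ∈ D) ∧
      (∃ a : ι → ZMod 2 × ZMod 2, ∀ i ∈ D, a i ≠ 0 ∧ a (p i) = a i + c (p i)) ∧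
      ∀ x : ι → ℤ, ∑ i ∈ D, x i = 0 → ∃ g : ι → ℤ, ∀ i ∈ D, g (p i) = g i + x (p i) := by
  classical
  obtain ⟨l, hl, hlD, s, hs⟩ := exists_list_avoidsZero D c hc hsum
  have hD : l.toFinset = D := by ext i; rw [List.mem_toFinset, hlD]
  have hlsum : ∀ {N : Type} [AddCommGroup N] (x : ι → N), ∑ i ∈ D, x i = 0 →
      (l.map x).sum = 0 := by
    intro N _ x hx
    rw [← List.sum_toFinset x hl, hD, hx]
  refine ⟨l.formPerm, fun i => by rw [← hlD, ← hlD, List.formPerm_mem_iff_mem],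
    ⟨listPotential l c s, fun i hi => ⟨hs.add_sum_take_ne_zero _, ?_⟩⟩, fun x hx =>
    ⟨listPotential l x 0, fun i hi => ?_⟩⟩
  · exact listPotential_formPerm hl (hlsum c hsum) s ((hlD i).2 hi)
  · exact listPotential_formPerm hl (hlsum x hx) 0 ((hlD i).2 hi)

end Cyclic

/-! ### Orientations and flows -/

variable {α β : Type*} {G : Graph α β}

theorem IsFiniteLoopless.finite_incidenceSet (h : IsFiniteLoopless G) (v : α) :
    (G.incidenceSet v).Finite :=
  h.finite_edgeSet.subset (G.incidenceSet_subset_edgeSet v)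

theorem incidenceSet_eq_empty {v : α} (hv : v ∉ V(G)) : G.incidenceSet v = ∅ :=
  Set.eq_empty_of_forall_notMem fun _ he => hv he.vertex_mem

theorem boundary_eq_zero_of_notMem (τ : β → α → ℤˣ) (f : β → ℤ) {v : α} (hv : v ∉ V(G)) :
    boundary G τ f v = 0 := by
  simp [boundary, incidenceSet_eq_empty hv]

theorem other_other {e : β} {v : α} (h : G.Inc e v) (h' : G.Inc e h.other) : h'.other = v :=
  h'.isLink_other.right_unique h.isLink_other.symm

/-- A function on half edges that agrees on the two halves of each edge comes from a function on
edges. -/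
theorem exists_edge_function {M : Type*} [Zero M] (z : β → α → M)
    (hz : ∀ ⦃e u v⦄, G.IsLink e u v → z e u = z e v) :
    ∃ f : β → M, ∀ e v, G.Inc e v → f e = z e v := by
  classical
  refine ⟨fun e => if h : ∃ u, G.Inc e u then z e h.choose else 0, fun e v hv => ?_⟩
  have h : ∃ u, G.Inc e u := ⟨v, hv⟩
  simp only [dif_pos h]
  obtain ⟨w, hw⟩ := hv
  rcases h.choose_spec.eq_or_eq_of_isLink hw with h' | h'
  · rw [h']
  · rw [h', hz hw]

theorem units_mul_eq_neg_one {a b : ℤˣ} (h : a * b = -1) : a = -b := by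
  rcases Int.units_eq_one_or b with rfl | rfl <;> simp_all

/-- An even set of edges has an Eulerian orientation. -/
theorem exists_eulerian_orientation (S : Set β) (hL : G.Loopless)
    (hfin : ∀ v, (G.incidenceSet v).Finite)
    (heven : ∀ v, Even (S ∩ G.incidenceSet v).ncard) :
    ∃ y : β → α → ℤ, (∀ ⦃e u v⦄, G.IsLink e u v → y e u = -y e v) ∧
      (∀ e v, e ∈ S → G.Inc e v → y e v = 1 ∨ y e v = -1) ∧ (∀ e v, e ∉ S → y e v = 0) ∧
      ∀ v, ∑ᶠ e ∈ G.incidenceSet v, y e v = 0 := by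
  classical
  have hpair := fun v => exists_involutive_of_even_ncard ((hfin v).inter_of_right S) (heven v)
  choose p hp hp' using hpair
  -- On half edges over `S`, `a` passes to the other end of the edge and `b` to the partner at the
  -- same vertex. A sign alternating under both is an Eulerian orientation.
  let X := {q : β × α // q.1 ∈ S ∧ G.Inc q.1 q.2}
  let a : X → X := fun q => ⟨(q.1.1, q.2.2.other), q.2.1, q.2.2.inc_other⟩
  let b : X → X := fun q => ⟨(p q.1.2 ⟨q.1.1, q.2⟩, q.1.2), (p q.1.2 ⟨q.1.1, q.2⟩).2⟩
  have ha : Function.Involutive a := fun q =>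
    Subtype.ext (Prod.ext rfl (other_other q.2.2 q.2.2.inc_other))
  have hb : Function.Involutive b := fun q =>
    Subtype.ext (Prod.ext (congrArg Subtype.val (hp q.1.2 ⟨q.1.1, q.2⟩)) rfl)
  obtain ⟨χ, hχa, hχb⟩ := exists_sign_of_involutive_of_involutive a b ha hb
    (fun q h => by
      have h' : q.2.2.other = q.1.2 := congrArg (fun r : X => r.1.2) h
      exact q.2.2.isLink_other.ne h'.symm)
    (fun q h => hp' q.1.2 ⟨q.1.1, q.2⟩ (Subtype.ext (congrArg (fun r : X => r.1.1) h)))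
  let y : β → α → ℤ := fun e v => if h : e ∈ S ∧ G.Inc e v then χ ⟨(e, v), h⟩ else 0
  have hy : ∀ q : X, y q.1.1 q.1.2 = χ q := fun q => dif_pos q.2
  have hy0 : ∀ e v, e ∉ S → y e v = 0 := fun e v he => dif_neg fun h => he h.1
  refine ⟨y, fun e u v huv => ?_, fun e v he hv => ?_, hy0, fun v => ?_⟩
  · by_cases he : e ∈ S
    · let q : X := ⟨(e, v), he, huv.inc_right⟩
      have hq : a q = ⟨(e, u), he, huv.inc_left⟩ :=
        Subtype.ext (Prod.ext rfl (q.2.2.isLink_other.right_unique huv.symm))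
      have h1 := hy (a q)
      rw [hχa, Units.val_neg, ← hy q, hq] at h1
      exact h1
    · simp [hy0 _ _ he]
  · rw [hy ⟨(e, v), he, hv⟩]
    rcases Int.units_eq_one_or (χ ⟨(e, v), he, hv⟩) with h | h <;> simp [h]
  · have h1 : ∑ᶠ e ∈ G.incidenceSet v, y e v = ∑ᶠ e ∈ S ∩ G.incidenceSet v, y e v := by
      refine finsum_mem_inter_support_eq _ _ _ ?_
      ext e
      by_cases he : e ∈ S
      · simp [he]
      · simp [hy0 _ v he]
    rw [h1, ← finsum_set_coe_eq_finsum_mem]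
    -- Reindexing by the pairing at `v` negates every term.
    have h2 : ∑ᶠ i : ↥(S ∩ G.incidenceSet v), y i v = -∑ᶠ i : ↥(S ∩ G.incidenceSet v), y i v := by
      rw [← finsum_neg_distrib, ← finsum_comp_equiv (hp v).toPerm]
      refine finsum_congr fun i => ?_
      let q : X := ⟨(i, v), i.2⟩
      have := hχb q
      have h3 := hy (b q)
      rw [this, Units.val_neg, ← hy q] at h3
      exact h3
    omega

/-- A nowhere-zero `k`-flow of an unsigned graph, given by the outflow along each half edge. -/
theorem admitsNZF_one_of_skew {k : ℕ} (x : β → α → ℤ)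
    (hskew : ∀ ⦃e u v⦄, G.IsLink e u v → x e u = -x e v)
    (hne : ∀ e v, G.Inc e v → x e v ≠ 0) (hlt : ∀ e v, G.Inc e v → |x e v| < k)
    (hsum : ∀ v, ∑ᶠ e ∈ G.incidenceSet v, x e v = 0) : AdmitsNZF G (fun _ => 1) k := by
  obtain ⟨f, hf⟩ := exists_edge_function (G := G) (fun e v => |x e v|)
    (fun e u v h => by simp [hskew h])
  have hinc : ∀ e ∈ E(G), ∃ v, G.Inc e v := fun e he => by
    obtain ⟨u, v, h⟩ := G.exists_isLink_of_mem_edgeSet he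
    exact ⟨u, v, h⟩
  refine ⟨fun e v => if 0 < x e v then 1 else -1, f, ⟨⟨?_, ?_, ?_⟩, ?_⟩⟩
  · intro e u v h
    have h1 := hskew h
    have h2 := hne e u h.inc_left
    rcases lt_or_gt_of_ne h2 with h3 | h3
    · have h4 : 0 < x e v := by omega
      simp [h3.not_gt, h4]
    · have h4 : ¬ 0 < x e v := by omega
      simp [h3, h4]
  · intro v _
    refine Eq.trans (finsum_mem_congr rfl fun e he => ?_) (hsum v)
    rw [hf e v he]
    beta_reduce
    split_ifs with h
    · simp [abs_of_pos h]
    · simp [abs_of_nonpos (not_lt.1 h)]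
  · intro e he
    obtain ⟨v, hv⟩ := hinc e he
    simpa [hf e v hv] using hlt e v hv
  · intro e he
    obtain ⟨v, hv⟩ := hinc e he
    simpa [hf e v hv] using hne e v hv

/-- All three colours occur at each vertex, so omitting one leaves an even edge set. With `y₁`
omitting colour 2 and `y₂` omitting colour 0, the values of `y₁ + 2 * y₂` are `±1` on colour 0, `±2`
on colour 2, and `±1` or `±3` on colour 1. -/
theorem isFourNZFAdmissible_of_isThreeEdgeColorable (h : IsFiniteLoopless G) (hcub : IsCubic G)
    (hcol : IsThreeEdgeColorable G) : IsFourNZFAdmissible G := by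
  obtain ⟨c, hc⟩ := hcol
  have heven : ∀ (m : Fin 3) v, Even ({e | c e ≠ m} ∩ G.incidenceSet v).ncard := by
    intro m v
    by_cases hv : v ∈ V(G)
    · have himg : c '' G.incidenceSet v = Set.univ := by
        refine Set.eq_of_subset_of_ncard_le (Set.subset_univ _) ?_
        rw [(hc v hv).ncard_image, hcub v hv, Set.ncard_univ, Nat.card_eq_fintype_card,
          Fintype.card_fin]
      have himg' : c '' ({e | c e ≠ m} ∩ G.incidenceSet v) = {m}ᶜ := by
        ext i
        constructor
        · rintro ⟨e, he, rfl⟩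
          exact he.1
        · intro hi
          obtain ⟨e, he, rfl⟩ : i ∈ c '' G.incidenceSet v := himg ▸ Set.mem_univ i
          exact ⟨e, ⟨hi, he⟩, rfl⟩
      rw [← ((hc v hv).mono Set.inter_subset_right).ncard_image, himg', Set.ncard_compl]
      simp
    · simp [incidenceSet_eq_empty hv]
  obtain ⟨y₁, hs₁, hS₁, hn₁, hb₁⟩ := exists_eulerian_orientation _ h.loopless
    h.finite_incidenceSet (heven 2)
  obtain ⟨y₂, hs₂, hS₂, hn₂, hb₂⟩ := exists_eulerian_orientation _ h.loopless
    h.finite_incidenceSet (heven 0)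
  have hval : ∀ e v, G.Inc e v → y₁ e v + 2 * y₂ e v ≠ 0 ∧ |y₁ e v + 2 * y₂ e v| < 4 := by
    intro e v he
    have h1 := hS₁ e v
    have h2 := hS₂ e v
    have h3 := hn₁ e v
    have h4 := hn₂ e v
    simp only [Set.mem_ofPred_eq, not_not] at h1 h2 h3 h4
    by_cases hc2 : c e = 2
    · have hc0 : c e ≠ 0 := by rw [hc2]; decide
      rcases h2 hc0 he with h | h <;> simp [h3 hc2, h]
    · by_cases hc0 : c e = 0
      · rcases h1 hc2 he with h | h <;> simp [h4 hc0, h]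
      · rcases h1 hc2 he with h | h <;> rcases h2 hc0 he with h' | h' <;> simp [h, h']
  refine admitsNZF_one_of_skew (fun e v => y₁ e v + 2 * y₂ e v) (fun e u v huv => ?_)
    (fun e v he => (hval e v he).1) (fun e v he => (hval e v he).2) fun v => ?_
  · simp only [hs₁ huv, hs₂ huv]
    ring
  · rw [finsum_mem_add_distrib (h.finite_incidenceSet v), hb₁, ← mul_finsum_mem, hb₂]
    simp

/-- A nowhere-zero `4`-flow gives a nowhere-zero flow with values in the Klein four-group. -/
theorem exists_klein_flow (h : IsFiniteLoopless G) (h4 : IsFourNZFAdmissible G) :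
    ∃ c : β → ZMod 2 × ZMod 2, (∀ e ∈ E(G), c e ≠ 0) ∧
      ∀ v, ∑ᶠ e ∈ G.incidenceSet v, c e = 0 := by
  obtain ⟨τ, f, hf⟩ := h4
  have hskew : ∀ ⦃e u v⦄, G.IsLink e u v → (τ e u : ℤ) * f e = -(τ e v * f e) := by
    intro e u v huv
    rw [units_mul_eq_neg_one (hf.isOrientation huv)]
    simp
  have hsum : ∀ v, ∑ᶠ e ∈ G.incidenceSet v, (τ e v : ℤ) * f e = 0 := by
    intro v
    by_cases hv : v ∈ V(G)
    · exact hf.boundary_eq_zero v hv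
    · exact boundary_eq_zero_of_notMem τ f hv
  have hcast : ∀ e v, (((τ e v : ℤ) * f e : ℤ) : ZMod 2) = f e := by
    intro e v
    rcases Int.units_eq_one_or (τ e v) with h | h <;> simp [h, ZMod.neg_eq_self_mod_two]
  have hsum2 : ∀ v, ∑ᶠ e ∈ G.incidenceSet v, (f e : ZMod 2) = 0 := by
    intro v
    have := (Int.castAddHom (ZMod 2)).map_finsum_mem (fun e => (τ e v : ℤ) * f e)
      (h.finite_incidenceSet v)
    rw [hsum v, map_zero] at this
    rw [this]
    exact finsum_mem_congr rfl fun e _ => (hcast e v).symm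
  have heven : ∀ v, Even ({e | Odd (f e)} ∩ G.incidenceSet v).ncard := by
    classical
    intro v
    obtain ⟨t, ht⟩ := (h.finite_incidenceSet v).exists_finset_coe
    have hval : ∀ e, (f e : ZMod 2) = if Odd (f e) then 1 else 0 := by
      intro e
      split_ifs with ho
      · obtain ⟨m, hm⟩ := ho
        rw [hm]
        push_cast
        rw [show (2 : ZMod 2) = 0 from rfl, zero_mul, zero_add]
      · rw [ZMod.intCast_zmod_eq_zero_iff_dvd]
        exact_mod_cast (Int.not_odd_iff_even.1 ho).two_dvd
    have hset : {e | Odd (f e)} ∩ G.incidenceSet v = ↑(t.filter fun e => Odd (f e)) := by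
      ext e
      simp [← ht, and_comm]
    have h0 := hsum2 v
    rw [← ht, finsum_mem_coe_finset, Finset.sum_congr rfl fun e _ => hval e, Finset.sum_boole,
      ZMod.natCast_eq_zero_iff_even] at h0
    rwa [hset, Set.ncard_coe_finset]
  obtain ⟨y, hys, hyS, hyn, hyb⟩ := exists_eulerian_orientation _ h.loopless
    h.finite_incidenceSet heven
  have hpar : ∀ e v, G.Inc e v → Even ((τ e v : ℤ) * f e + y e v) := by
    intro e v he
    have ht : Even ((τ e v : ℤ) * f e) ↔ Even (f e) := by
      rcases Int.units_eq_one_or (τ e v) with h | h <;> simp [h]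
    rw [Int.even_add, ht]
    by_cases ho : Odd (f e)
    · rcases hyS e v ho he with h | h <;> simpa [h] using ho
    · simpa [hyn e v ho] using ho
  -- Adding an Eulerian orientation of the odd edges makes the flow even, so half of it is again an
  -- integer flow. Its parity is the second Klein coordinate.
  let z : β → α → ℤ := fun e v => ((τ e v : ℤ) * f e + y e v) / 2
  have hz : ∀ e v, G.Inc e v → 2 * z e v = (τ e v : ℤ) * f e + y e v := fun e v he =>
    Int.mul_ediv_cancel' (hpar e v he).two_dvd
  have hzsum : ∀ v, ∑ᶠ e ∈ G.incidenceSet v, z e v = 0 := by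
    intro v
    have h1 : 2 * ∑ᶠ e ∈ G.incidenceSet v, z e v = 0 := by
      rw [mul_finsum_mem, finsum_mem_congr (s := G.incidenceSet v) rfl fun e he => hz e v he,
        finsum_mem_add_distrib (h.finite_incidenceSet v), hsum, hyb, add_zero]
    omega
  obtain ⟨w, hw⟩ := exists_edge_function (G := G) (fun e v => (z e v : ZMod 2))
    (fun e u v huv => by
      have h1 := hz e u huv.inc_left
      have h2 := hz e v huv.inc_right
      rw [hskew huv, hys huv] at h1
      have h3 : z e u = -z e v := by omega
      simp [h3, ZMod.neg_eq_self_mod_two])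
  refine ⟨fun e => (f e, w e), fun e he h0 => ?_, fun v => Prod.ext ?_ ?_⟩
  -- If the first coordinate vanishes, then `f e = ±2` and `y e u = 0`, so `z e u = ±1` is odd.
  · obtain ⟨u, v, huv⟩ := G.exists_isLink_of_mem_edgeSet he
    have h1 : (f e : ZMod 2) = 0 := congrArg Prod.fst h0
    have h2 : w e = 0 := congrArg Prod.snd h0
    rw [hw e u huv.inc_left] at h2
    rw [ZMod.intCast_zmod_eq_zero_iff_dvd] at h1 h2
    have h3 := hz e u huv.inc_left
    have hno : ¬ Odd (f e) := by
      rw [Int.not_odd_iff_even]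
      exact even_iff_two_dvd.2 (by exact_mod_cast h1)
    rw [hyn e u hno] at h3
    have h5 := abs_lt.1 (hf.abs_lt e he)
    have h6 := hf.ne_zero e he
    push_cast at h1 h2 h5
    rcases Int.units_eq_one_or (τ e u) with h | h <;> simp only [h] at h3 <;> push_cast at h3 <;>
      omega
  · have := (AddMonoidHom.fst (ZMod 2) (ZMod 2)).map_finsum_mem (fun e => ((f e : ZMod 2), w e))
      (h.finite_incidenceSet v)
    exact this.trans (hsum2 v)
  · have := (AddMonoidHom.snd (ZMod 2) (ZMod 2)).map_finsum_mem (fun e => ((f e : ZMod 2), w e))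
      (h.finite_incidenceSet v)
    refine this.trans ?_
    have h2 := (Int.castAddHom (ZMod 2)).map_finsum_mem (fun e => z e v)
      (h.finite_incidenceSet v)
    rw [hzsum v, map_zero] at h2
    rw [Prod.snd_zero, h2]
    exact finsum_mem_congr rfl fun e he => hw e v he

/-! ### Expanding vertices into circuits -/

/-- The expansion of `G` along a permutation `p` of its half edges: each half edge becomes a vertex,
each edge of `G` joins its two halves, and each half edge is joined to its image under `p`. -/
def expansion (G : Graph α β) (p : Equiv.Perm (β × α))
    (hp : ∀ h, G.Inc (p h).1 (p h).2 ↔ G.Inc h.1 h.2) : Graph (β × α) (β ⊕ β × α) where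
  vertexSet := {h | G.Inc h.1 h.2}
  IsLink e x y := Sum.elim (fun e => x.1 = e ∧ y.1 = e ∧ G.IsLink e x.2 y.2)
    (fun h => G.Inc h.1 h.2 ∧ ((x = h ∧ y = p h) ∨ (y = h ∧ x = p h))) e
  isLink_symm := by
    rintro (e | h) -
    · exact ⟨fun x y hxy => ⟨hxy.2.1, hxy.1, hxy.2.2.symm⟩⟩
    · exact ⟨fun x y hxy => ⟨hxy.1, hxy.2.symm⟩⟩
  eq_or_eq_of_isLink_of_isLink := by
    rintro (e | h) x y v w hxy hvw
    · rcases hxy.2.2.left_eq_or_eq hvw.2.2 with h | h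
      · exact Or.inl (Prod.ext (hxy.1.trans hvw.1.symm) h)
      · exact Or.inr (Prod.ext (hxy.1.trans hvw.2.1.symm) h)
    · rcases hxy.2 with h1 | h1 <;> rcases hvw.2 with h2 | h2 <;> simp [h1, h2]
  left_mem_of_isLink := by
    rintro (e | h) x y hxy
    · have := hxy.2.2.inc_left
      rw [← hxy.1] at this
      exact this
    · rcases hxy.2 with h1 | h1
      · rw [h1.1]; exact hxy.1
      · rw [h1.2]; exact (hp h).2 hxy.1

section expansion

variable {p : Equiv.Perm (β × α)} {hp : ∀ h, G.Inc (p h).1 (p h).2 ↔ G.Inc h.1 h.2}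

theorem expansion_isLink_inl {e : β} {x y : β × α} :
    (expansion G p hp).IsLink (Sum.inl e) x y ↔ x.1 = e ∧ y.1 = e ∧ G.IsLink e x.2 y.2 :=
  Iff.rfl

theorem mem_vertexSet_expansion {h : β × α} : h ∈ V(expansion G p hp) ↔ G.Inc h.1 h.2 :=
  Iff.rfl

theorem inl_mem_edgeSet_expansion {e : β} : Sum.inl e ∈ E(expansion G p hp) ↔ e ∈ E(G) := by
  constructor
  · rintro ⟨x, y, hxy⟩
    exact hxy.2.2.edge_mem
  · intro he
    obtain ⟨u, v, huv⟩ := G.exists_isLink_of_mem_edgeSet he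
    exact ⟨(e, u), (e, v), rfl, rfl, huv⟩

theorem inr_mem_edgeSet_expansion {h : β × α} :
    Sum.inr h ∈ E(expansion G p hp) ↔ G.Inc h.1 h.2 :=
  ⟨fun ⟨_, _, hxy⟩ => hxy.1, fun hh => ⟨h, p h, hh, Or.inl ⟨rfl, rfl⟩⟩⟩

theorem inc_symm_iff (hp : ∀ h, G.Inc (p h).1 (p h).2 ↔ G.Inc h.1 h.2) (h : β × α) :
    G.Inc (p.symm h).1 (p.symm h).2 ↔ G.Inc h.1 h.2 := by
  rw [← hp (p.symm h), Equiv.apply_symm_apply]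

theorem incidenceSet_expansion {h : β × α} (hh : G.Inc h.1 h.2) :
    (expansion G p hp).incidenceSet h = {Sum.inl h.1, Sum.inr h, Sum.inr (p.symm h)} := by
  ext e
  rw [Graph.mem_incidenceSet]
  constructor
  · rintro ⟨y, hy⟩
    rcases e with e | h'
    · rw [expansion_isLink_inl] at hy
      simp [hy.1]
    · rcases hy.2 with h1 | h1
      · simp [h1.1]
      · simp [h1.2]
  · rintro (rfl | rfl | rfl)
    · obtain ⟨w, hw⟩ := hh
      exact ⟨(h.1, w), rfl, rfl, hw⟩
    · exact ⟨p h, hh, Or.inl ⟨rfl, rfl⟩⟩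
    · exact ⟨p.symm h, (inc_symm_iff hp h).2 hh, Or.inr ⟨rfl, (p.apply_symm_apply h).symm⟩⟩

theorem ncard_incidenceSet_expansion (hne : ∀ h, G.Inc h.1 h.2 → p h ≠ h) {h : β × α}
    (hh : G.Inc h.1 h.2) : ((expansion G p hp).incidenceSet h).ncard = 3 := by
  rw [incidenceSet_expansion hh]
  refine Set.ncard_eq_three.2 ⟨_, _, _, by simp, by simp, ?_, rfl⟩
  intro h0
  have h1 := Sum.inr_injective h0
  exact hne h hh ((congrArg p h1).trans (p.apply_symm_apply h))

theorem boundary_expansion (hne : ∀ h, G.Inc h.1 h.2 → p h ≠ h) {h : β × α}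
    (hh : G.Inc h.1 h.2) (τ : β ⊕ β × α → β × α → ℤˣ) (f : β ⊕ β × α → ℤ) :
    boundary (expansion G p hp) τ f h =
      τ (Sum.inl h.1) h * f (Sum.inl h.1) + (τ (Sum.inr h) h * f (Sum.inr h) +
        τ (Sum.inr (p.symm h)) h * f (Sum.inr (p.symm h))) := by
  have hne' : Sum.inr h ≠ (Sum.inr (p.symm h) : β ⊕ β × α) := fun h0 =>
    hne h hh ((congrArg p (Sum.inr_injective h0)).trans (p.apply_symm_apply h))
  rw [boundary, incidenceSet_expansion hh,
    finsum_mem_insert _ (by simp) (Set.toFinite _), finsum_mem_pair hne']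

theorem finite_halfEdges (h : IsFiniteLoopless G) : {q : β × α | G.Inc q.1 q.2}.Finite :=
  (h.finite_edgeSet.prod h.finite_vertexSet).subset fun _ hq => ⟨hq.edge_mem, hq.vertex_mem⟩

theorem isFiniteLoopless_expansion (h : IsFiniteLoopless G)
    (hne : ∀ h, G.Inc h.1 h.2 → p h ≠ h) : IsFiniteLoopless (expansion G p hp) where
  finite_vertexSet := finite_halfEdges h
  finite_edgeSet := by
    refine ((h.finite_edgeSet.image Sum.inl).union
      ((finite_halfEdges h).image Sum.inr)).subset ?_
    rintro (e | q) he
    · exact Or.inl ⟨e, inl_mem_edgeSet_expansion.1 he, rfl⟩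
    · exact Or.inr ⟨q, inr_mem_edgeSet_expansion.1 he, rfl⟩
  loopless := by
    have := h.loopless
    refine ⟨?_⟩
    rintro (e | q) x hx
    · exact hx.2.2.ne rfl
    · rcases hx.2 with h1 | h1
      · exact hne q hx.1 (h1.2.symm.trans h1.1)
      · exact hne q hx.1 (h1.2.symm.trans h1.1)

/-- The edges at `h` carry `c h.1`, `a h` and `a (p.symm h)`. These are nonzero and sum to zero in
the Klein four-group, so they are distinct. -/
theorem isThreeEdgeColorable_expansion (c : β → ZMod 2 × ZMod 2) (a : β × α → ZMod 2 × ZMod 2)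
    (hc : ∀ e ∈ E(G), c e ≠ 0)
    (ha : ∀ h, G.Inc h.1 h.2 → a h ≠ 0 ∧ a (p h) = a h + c (p h).1) :
    IsThreeEdgeColorable (expansion G p hp) := by
  obtain ⟨φ, hφ⟩ : ∃ φ : ZMod 2 × ZMod 2 → Fin 3, ∀ x y, x ≠ 0 → y ≠ 0 → φ x = φ y → x = y :=
    ⟨fun x => if x = (1, 0) then 0 else if x = (0, 1) then 1 else 2, by decide⟩
  have hinc : ∀ h, G.Inc h.1 h.2 → a h = a (p.symm h) + c h.1 := by
    intro h hh
    have := (ha (p.symm h) ((inc_symm_iff hp h).2 hh)).2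
    rwa [p.apply_symm_apply] at this
  have hdist : ∀ x y z : ZMod 2 × ZMod 2, x ≠ 0 → y ≠ 0 → z ≠ 0 → y = z + x →
      x ≠ y ∧ x ≠ z ∧ y ≠ z := by decide
  refine ⟨fun e => φ (Sum.elim c a e), fun h hh => ?_⟩
  rw [incidenceSet_expansion hh]
  rw [mem_vertexSet_expansion] at hh
  have h1 := hc h.1 hh.edge_mem
  have h2 := (ha h hh).1
  have h3 := (ha _ ((inc_symm_iff hp h).2 hh)).1
  obtain ⟨h12, h13, h23⟩ := hdist _ _ _ h1 h2 h3 (hinc h hh)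
  have g12 := mt (hφ _ _ h1 h2) h12
  have g13 := mt (hφ _ _ h1 h3) h13
  have g23 := mt (hφ _ _ h2 h3) h23
  rintro x (rfl | rfl | rfl) y (rfl | rfl | rfl) hxy <;>
    first
    | rfl
    | exact absurd hxy g12
    | exact absurd hxy g13
    | exact absurd hxy g23
    | exact absurd hxy.symm g12
    | exact absurd hxy.symm g13
    | exact absurd hxy.symm g23

/-- The signature of the expansion that is positive on the new edges. -/
def expansionSignature (α : Type*) {β : Type*} (σ : β → ℤˣ) : β ⊕ β × α → ℤˣ :=
  Sum.elim σ fun _ => 1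

/-- Flows of the expansion restrict to flows of `G`, since the new edges are positive and `p` moves
half edges only within a vertex. -/
theorem admitsNZF_of_expansion (h : IsFiniteLoopless G)
    (hp2 : ∀ h, (p h).2 = h.2) (hne : ∀ h, G.Inc h.1 h.2 → p h ≠ h) {σ : β → ℤˣ} {k : ℕ}
    (hk : AdmitsNZF (expansion G p hp) (expansionSignature α σ) k) : AdmitsNZF G σ k := by
  classical
  obtain ⟨τ, f, hf⟩ := hk
  refine ⟨fun e v => τ (Sum.inl e) (e, v), fun e => f (Sum.inl e), ⟨⟨?_, ?_, ?_⟩, ?_⟩⟩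
  · intro e u v huv
    exact hf.isOrientation (e := Sum.inl e) (u := (e, u)) (v := (e, v)) ⟨rfl, rfl, huv⟩
  · intro v _
    obtain ⟨t, ht⟩ := (h.finite_incidenceSet v).exists_finset_coe
    have hmem : ∀ e, e ∈ t ↔ G.Inc e v := fun e => by
      rw [← Finset.mem_coe, ht, Graph.mem_incidenceSet]
    have hb : ∀ e ∈ t, (τ (Sum.inl e) (e, v) : ℤ) * f (Sum.inl e) =
        -(τ (Sum.inr (e, v)) (e, v) * f (Sum.inr (e, v))) -
          τ (Sum.inr (p.symm (e, v))) (e, v) * f (Sum.inr (p.symm (e, v))) := by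
      intro e he
      have h1 := boundary_expansion (hp := hp) hne (h := (e, v)) ((hmem e).1 he) τ f
      rw [hf.boundary_eq_zero (e, v) ((hmem e).1 he)] at h1
      linarith
    have hsym2 : ∀ q, (p.symm q).2 = q.2 := fun q => by
      rw [← hp2 (p.symm q), p.apply_symm_apply]
    -- Reindexing by `p` gathers the contributions of both ends of each circuit edge, which cancel
    -- because that edge is positive.
    have hshift : ∑ e ∈ t, (τ (Sum.inr (p.symm (e, v))) (e, v) : ℤ) * f (Sum.inr (p.symm (e, v))) =
        ∑ e ∈ t, (τ (Sum.inr (e, v)) (p (e, v)) : ℤ) * f (Sum.inr (e, v)) := by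
      refine Finset.sum_bij' (fun e _ => (p.symm (e, v)).1) (fun e _ => (p (e, v)).1)
        ?_ ?_ ?_ ?_ ?_
      · intro e he
        have := (inc_symm_iff hp (e, v)).2 ((hmem e).1 he)
        rw [hsym2] at this
        exact (hmem _).2 this
      · intro e he
        have := (hp (e, v)).2 ((hmem e).1 he)
        rw [hp2] at this
        exact (hmem _).2 this
      · intro e he
        have : ((p.symm (e, v)).1, v) = p.symm (e, v) := Prod.ext rfl (hsym2 (e, v)).symm
        simp [this]
      · intro e he
        have : ((p (e, v)).1, v) = p (e, v) := Prod.ext rfl (hp2 (e, v)).symm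
        simp [this]
      · intro e he
        have : ((p.symm (e, v)).1, v) = p.symm (e, v) := Prod.ext rfl (hsym2 (e, v)).symm
        simp [this]
    have hcancel : ∀ e ∈ t, (τ (Sum.inr (e, v)) (p (e, v)) : ℤ) =
        -τ (Sum.inr (e, v)) (e, v) := by
      intro e he
      have h1 := hf.isOrientation (e := Sum.inr (e, v)) (u := p (e, v)) (v := (e, v))
        ⟨(hmem e).1 he, Or.inr ⟨rfl, rfl⟩⟩
      rw [units_mul_eq_neg_one h1, Units.val_neg]
    rw [boundary, ← ht, finsum_mem_coe_finset, Finset.sum_congr rfl hb, Finset.sum_sub_distrib,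
      hshift, ← Finset.sum_sub_distrib]
    refine Finset.sum_eq_zero fun e he => ?_
    rw [hcancel e he]
    ring
  · intro e he
    exact hf.abs_lt _ (inl_mem_edgeSet_expansion.2 he)
  · intro e he
    exact hf.ne_zero _ (inl_mem_edgeSet_expansion.2 he)

/-- Nowhere-zero flows of `G` extend to the expansion if their values are increments along `p`. -/
theorem flowAdmissible_expansion (h : IsFiniteLoopless G)
    (hne : ∀ h, G.Inc h.1 h.2 → p h ≠ h) {σ : β → ℤˣ} {k : ℕ} {τ : β → α → ℤˣ} {f : β → ℤ}
    (hf : IsNowhereZeroFlow G σ k τ f) (g : β × α → ℤ)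
    (hg : ∀ h, G.Inc h.1 h.2 → g (p h) = g h - τ (p h).1 (p h).2 * f (p h).1) :
    FlowAdmissible (expansion G p hp) (expansionSignature α σ) := by
  classical
  obtain ⟨N, hN⟩ := ((finite_halfEdges h).image fun q => |g q|).bddAbove
  have hN' : ∀ q, G.Inc q.1 q.2 → |g q| ≤ N := fun q hq => hN ⟨q, hq, rfl⟩
  -- Circuit edges are directed from `q` to `p q`, so the constant `N + 1` cancels in every
  -- boundary, while it makes all circuit values positive.
  let f' : β ⊕ β × α → ℤ := Sum.elim f fun q => g q + (N + 1)
  obtain ⟨K, hK⟩ := ((isFiniteLoopless_expansion (hp := hp) h hne).finite_edgeSet.image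
    fun e => |f' e|).bddAbove
  refine ⟨K.toNat + 1,
    Sum.elim (fun e x => τ e x.2) (fun q x => if x = q then 1 else -1), f', ⟨⟨?_, ?_, ?_⟩, ?_⟩⟩
  · rintro (e | q) x y hxy
    · exact hf.isOrientation hxy.2.2
    · have h0 := hne q hxy.1
      rcases hxy.2 with ⟨rfl, rfl⟩ | ⟨rfl, rfl⟩ <;> simp [expansionSignature, h0]
  · intro q hq
    rw [boundary_expansion hne hq]
    have h1 := hg (p.symm q) ((inc_symm_iff hp q).2 hq)
    rw [p.apply_symm_apply] at h1
    have h2 : q ≠ p.symm q := fun h0 => hne q hq ((congrArg p h0).trans (p.apply_symm_apply q))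
    simp [f', h2]
    linarith
  · intro e he
    have := hK ⟨e, he, rfl⟩
    dsimp only at this
    push_cast
    omega
  · rintro (e | q) he
    · exact hf.ne_zero e (inl_mem_edgeSet_expansion.1 he)
    · have := abs_le.1 (hN' q (inr_mem_edgeSet_expansion.1 he))
      simp only [f', Sum.elim_inr]
      omega

end expansion

theorem admitsNZF_of_forall_isCubic {k : ℕ} {α β : Type u} {G : Graph α β} {σ : β → ℤˣ}
    (H : ∀ (α β : Type u) (G : Graph α β) (σ : β → ℤˣ), IsFiniteLoopless G → IsCubic G →
      IsThreeEdgeColorable G → FlowAdmissible G σ → AdmitsNZF G σ k)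
    (h : IsFiniteLoopless G) (h4 : IsFourNZFAdmissible G) (hσ : FlowAdmissible G σ) :
    AdmitsNZF G σ k := by
  classical
  obtain ⟨c, hc, hcsum⟩ := exists_klein_flow h h4
  have hloc : ∀ v, ∃ (p : Equiv.Perm β) (a : β → ZMod 2 × ZMod 2),
      (∀ e, G.Inc (p e) v ↔ G.Inc e v) ∧
      (∀ e, G.Inc e v → a e ≠ 0 ∧ a (p e) = a e + c (p e)) ∧
      ∀ x : β → ℤ, ∑ᶠ e ∈ G.incidenceSet v, x e = 0 →
        ∃ g : β → ℤ, ∀ e, G.Inc e v → g (p e) = g e + x (p e) := by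
    intro v
    obtain ⟨t, ht⟩ := (h.finite_incidenceSet v).exists_finset_coe
    have hmem : ∀ e, e ∈ t ↔ G.Inc e v := fun e => by
      rw [← Finset.mem_coe, ht, Graph.mem_incidenceSet]
    have hsum : ∑ e ∈ t, c e = 0 := by rw [← finsum_mem_coe_finset, ht, hcsum v]
    obtain ⟨p, hp, ⟨a, ha⟩, hx⟩ := exists_perm_potential t c
      (fun e he => hc e ((hmem e).1 he).edge_mem) hsum
    simp only [hmem] at hp ha hx
    refine ⟨p, a, hp, ha, fun x h0 => hx x ?_⟩
    rwa [← ht, finsum_mem_coe_finset] at h0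
  choose p a hp ha hx using hloc
  obtain ⟨k', τ, f, hf⟩ := hσ
  -- The flow leaving along a half edge is lost by the circuit, hence the negative increment.
  have hg := fun v => hx v (fun e => -((τ e v : ℤ) * f e)) (by
    have h0 : boundary G τ f v = 0 := by
      by_cases hv : v ∈ V(G)
      · exact hf.boundary_eq_zero v hv
      · exact boundary_eq_zero_of_notMem τ f hv
    rw [finsum_mem_neg_distrib _ (h.finite_incidenceSet v)]
    exact neg_eq_zero.2 h0)
  choose g hg using hg
  let P : Equiv.Perm (β × α) := Equiv.prodCongrLeft p
  have hP : ∀ q, G.Inc (P q).1 (P q).2 ↔ G.Inc q.1 q.2 := fun q => hp q.2 q.1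
  have hA : ∀ q : β × α, G.Inc q.1 q.2 → a q.2 q.1 ≠ 0 ∧
      a (P q).2 (P q).1 = a q.2 q.1 + c (P q).1 := fun q hq => ha q.2 q.1 hq
  -- A fixed half edge would have a zero increment, but the increment is the nonzero label `c`.
  have hne : ∀ q, G.Inc q.1 q.2 → P q ≠ q := by
    intro q hq h0
    have h1 := (hA q hq).2
    rw [h0, left_eq_add] at h1
    exact hc _ hq.edge_mem h1
  refine admitsNZF_of_expansion (hp := hP) h (fun _ => rfl) hne (H _ _ _ _
    (isFiniteLoopless_expansion h hne) (fun q hq => ncard_incidenceSet_expansion hne hq)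
    (isThreeEdgeColorable_expansion c (fun q => a q.2 q.1) hc hA)
    (flowAdmissible_expansion h hne hf (fun q => g q.2 q.1) fun q hq => ?_))
  rw [sub_eq_add_neg]
  exact hg q.2 q.1 hq

end SignedFlow

theorem theorem3p3 (k : ℕ) (hk : 0 < k) :
    (∀ (α β : Type u) (G : Graph α β) (σ : β → ℤˣ), SignedFlow.IsFiniteLoopless G →
        SignedFlow.IsFourNZFAdmissible G → SignedFlow.FlowAdmissible G σ →
        SignedFlow.AdmitsNZF G σ k) ↔
    (∀ (α β : Type u) (G : Graph α β) (σ : β → ℤˣ), SignedFlow.IsFiniteLoopless G →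
        SignedFlow.IsCubic G → SignedFlow.IsThreeEdgeColorable G →
        SignedFlow.FlowAdmissible G σ → SignedFlow.AdmitsNZF G σ k) :=
  ⟨fun H α β G σ h hcub hcol hσ =>
    H α β G σ h (SignedFlow.isFourNZFAdmissible_of_isThreeEdgeColorable h hcub hcol) hσ,
   fun H _ _ _ _ h h4 hσ => SignedFlow.admitsNZF_of_forall_isCubic H h h4 hσ⟩
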